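/- Let $n\ge 2$. Let $U\subset \mathrm{GL}_n(\mathbb{R})$ be the group of upper-triangular matrices with $1$'s on the diagonal, and let $U_{\ge 0}\subset U$ be its totally nonnegative part, i.e. the set of $x\in U$ all of whose minors (of all orders) are nonnegative. Let $V_{\ge 0}$ be the set of $x\in U_{\ge 0}$ whose superdiagonal entries satisfy $x_{1,2}+x_{2,3}+\dots+x_{n-1,n}=n-1$ (the link of the identity matrix in $U_{\ge 0}$). Both sets carry the subspace topology. Then $V_{\ge 0}$ is homeomorphic to a closed ball of dimension $\binom n2-1$, and $U_{\ge 0}$ is homeomorphic to a closed half-space in $\mathbb{R}^{\binom n2}$. -/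

import Mathlib

/-- A real square matrix is totally nonnegative if all its minors (of all orders) are nonnegative:
rows `r 0 < r 1 < ⋯` and columns `c 0 < c 1 < ⋯` are selected in increasing order. -/
def IsTotallyNonneg {n : ℕ} (x : Matrix (Fin n) (Fin n) ℝ) : Prop :=
  ∀ (k : ℕ) (r c : Fin k → Fin n), StrictMono r → StrictMono c → 0 ≤ (x.submatrix r c).det

/-- The upper-triangular matrices with ones on the diagonal. They carry the subspace topology
of the space of `n × n` matrices, which on this set is also the one coming from `GL_n(ℝ)`. -/
def upperUnitriangular (n : ℕ) : Set (Matrix (Fin n) (Fin n) ℝ) :=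
  {x | (∀ i, x i i = 1) ∧ ∀ i j, j < i → x i j = 0}

/-- `U_{≥0}`: the totally nonnegative upper unitriangular matrices. -/
def unipotentNonneg (n : ℕ) : Set (Matrix (Fin n) (Fin n) ℝ) :=
  {x | x ∈ upperUnitriangular n ∧ IsTotallyNonneg x}

/-- `V_{≥0}`, the link of the identity in `U_{≥0}`: those `x ∈ U_{≥0}` whose superdiagonal
entries `x_{1,2}, …, x_{n-1,n}` sum to `n - 1`. -/
def linkNonneg (n : ℕ) : Set (Matrix (Fin n) (Fin n) ℝ) :=
  {x | x ∈ unipotentNonneg n ∧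
    ∑ i : Fin (n - 1), x ⟨i, by omega⟩ ⟨i + 1, by omega⟩ = (n : ℝ) - 1}

/-- The closed half-space of `ℝ^N` of all points whose coordinate number `i` is nonnegative. -/
def closedHalfSpace {N : ℕ} (i : Fin N) : Set (EuclideanSpace ℝ (Fin N)) :=
  {y | 0 ≤ y i}

/-!
Let `e` be the matrix with ones on the superdiagonal and `exp(te)` its exponential, with entries
`t ^ (j - i) / (j - i)!`. Let `dilate s` multiply the `d`-th superdiagonal by `s ^ d`; it preserves
total nonnegativity, and it is a group endomorphism with `dilate s (exp(te)) = exp(ste)`. The maps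
`x ↦ exp(e) · dilate s (exp(-e) x) = exp((1 - s)e) · dilate s x` for `0 ≤ s ≤ 1` form a
multiplicative flow on the unipotent group that contracts to `exp(e)` and preserves the sum of the
superdiagonal entries if that sum is `n - 1` (`expShift_mul_dilate`).

For `s < 1` this flow maps the link `V_{≥0}` into its own interior. Indeed all minors of
`exp(te)`, `t > 0`, are positive, except for those that vanish on every upper-triangular matrix
(`expMinor_nonneg_and_pos`), and by the Cauchy–Binet formula the product of `exp(te)` with a
totally nonnegative unitriangular matrix has the same property (`expShift_mul_mem_minorsPos`), which
is an open condition. The link is compact, because `x i j ≤ x i k * x k j` bounds all entries by the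
superdiagonal ones.

By its left-hand form the flow is, up to translation by `exp(-e)`, a weighted dilation, and after
taking signed roots of the entries it becomes scalar multiplication on a vector space of dimension
`n.choose 2 - 1` (`flowChart`). The link thus becomes a compact set `K` with `s • K ⊆ interior K`
for `0 ≤ s < 1`. The gauge of such a set is continuous, and rescaling along rays makes `K` a ball
(`nonempty_homeomorph_closedBall`).

Finally `dilate` exhibits `U_{≥0}` as the cone over `V_{≥0}` with apex the identity
(`unipotentNonnegHomeoCone`), and the cone `‖w‖ ≤ s` over a ball is straightened to a half-space
by `(s, w) ↦ (s - ‖w‖, w)`.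
-/

open scoped Topology Pointwise

/-! ### The Cauchy–Binet formula and products of totally nonnegative matrices -/

theorem Matrix.det_mul_eq_sum_rows {k : ℕ} {ι : Type*} [Fintype ι] [DecidableEq ι]
    (A : Matrix (Fin k) ι ℝ) (B : Matrix ι (Fin k) ℝ) :
    (A * B).det = ∑ f : Fin k → ι, (∏ i, A i (f i)) * (B.submatrix f id).det := by
  have h : (A * B) = fun i => ∑ j, A i j • B j := by
    ext i l
    simp [Matrix.mul_apply, Finset.sum_apply]
  change Matrix.detRowAlternating.toMultilinearMap (A * B) = _
  rw [h, MultilinearMap.map_sum]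
  refine Finset.sum_congr rfl fun f _ => ?_
  exact MultilinearMap.map_smul_univ _ (fun i => A i (f i)) (fun i => B (f i))

/-- The Cauchy–Binet formula, summed over all selections `f` rather than over the increasing ones:
each increasing selection is then counted `k!` times. -/
theorem Matrix.factorial_mul_det_mul {k : ℕ} {ι : Type*} [Fintype ι] [DecidableEq ι]
    (A : Matrix (Fin k) ι ℝ) (B : Matrix ι (Fin k) ℝ) :
    (k.factorial : ℝ) * (A * B).det =
      ∑ f : Fin k → ι, (A.submatrix id f).det * (B.submatrix f id).det := by
  simp_rw [Matrix.det_apply' (A.submatrix id _), Finset.sum_mul]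
  rw [Finset.sum_comm]
  have h : ∀ σ : Equiv.Perm (Fin k),
      ∑ f : Fin k → ι, (((Equiv.Perm.sign σ : ℤ) : ℝ) *
        ∏ i, A.submatrix id f (σ i) i) * (B.submatrix f id).det = (A * B).det := by
    intro σ
    rw [Matrix.det_mul_eq_sum_rows, ← (Equiv.arrowCongr σ⁻¹ (Equiv.refl ι)).sum_comp]
    refine Finset.sum_congr rfl fun f _ => ?_
    have h1 : B.submatrix ((Equiv.arrowCongr σ⁻¹ (Equiv.refl ι)) f) id =
        (B.submatrix f id).submatrix σ id := by
      ext i j; simp [Equiv.arrowCongr, Equiv.Perm.inv_def]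
    have h2 : ∏ i, A.submatrix id ((Equiv.arrowCongr σ⁻¹ (Equiv.refl ι)) f) (σ i) i =
        ∏ i, A i (f i) := by
      rw [← Equiv.prod_comp σ fun i => A i (f i)]
      simp [Equiv.arrowCongr, Equiv.Perm.inv_def]
    rw [h1, h2, Matrix.det_permute]
    have h3 : ((Equiv.Perm.sign σ : ℤ) : ℝ) * ((Equiv.Perm.sign σ : ℤ) : ℝ) = 1 := by
      rcases Int.units_eq_one_or (Equiv.Perm.sign σ) with h | h <;> simp [h]
    linear_combination (∏ i, A i (f i)) * (B.submatrix f id).det * h3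
  rw [Finset.sum_congr rfl fun σ _ => h σ]
  simp [Fintype.card_perm]

/-- The summands of the Cauchy–Binet formula for two totally nonnegative matrices are nonnegative:
sorting an injective `f` changes the sign of both factors. -/
theorem IsTotallyNonneg.det_mul_det_nonneg {n k : ℕ} {x y : Matrix (Fin n) (Fin n) ℝ}
    (hx : IsTotallyNonneg x) (hy : IsTotallyNonneg y) {r c : Fin k → Fin n}
    (hr : StrictMono r) (hc : StrictMono c) (f : Fin k → Fin n) :
    0 ≤ (x.submatrix r f).det * (y.submatrix f c).det := by
  by_cases hf : Function.Injective f
  · have hs : StrictMono (f ∘ Tuple.sort f) :=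
      (Tuple.monotone_sort f).strictMono_of_injective (hf.comp (Equiv.injective _))
    have h1 := hx k r _ hr hs
    have h2 := hy k _ c hs hc
    have e1 : x.submatrix r (f ∘ Tuple.sort f) = (x.submatrix r f).submatrix id (Tuple.sort f) := rfl
    have e2 : y.submatrix (f ∘ Tuple.sort f) c = (y.submatrix f c).submatrix (Tuple.sort f) id := rfl
    rw [e1, Matrix.det_permute'] at h1
    rw [e2, Matrix.det_permute] at h2
    have h3 := mul_nonneg h1 h2
    rcases Int.units_eq_one_or (Equiv.Perm.sign (Tuple.sort f)) with h | h <;>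
      simpa [h] using h3
  · simp only [Function.Injective, not_forall] at hf
    obtain ⟨i, j, hij, hne⟩ := hf
    have : (y.submatrix f c).det = 0 :=
      Matrix.det_zero_of_row_eq hne (by ext l; simp [hij])
    simp [this]

/-! ### Minors of the exponential of the shift -/

theorem Matrix.det_eq_zero_of_zero_block {k : ℕ} (M : Matrix (Fin k) (Fin k) ℝ) (p : Fin k)
    (h : ∀ i j, p ≤ i → j ≤ p → M i j = 0) : M.det = 0 := by
  rw [Matrix.det_apply']
  refine Finset.sum_eq_zero fun σ _ => ?_
  -- some column `j ≤ p` is sent to a row `i ≥ p`, as there are too few rows `i < p`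
  obtain ⟨j, hj, hpj⟩ : ∃ j ≤ p, p ≤ σ j := by
    by_contra! hcon
    have h1 : (Finset.Iic p).card ≤ (Finset.Iio p).card :=
      Finset.card_le_card_of_injOn σ (fun j hj => by
        simpa using hcon j (by simpa using hj)) σ.injective.injOn
    simp at h1
  have h0 : ∏ i, M (σ i) i = 0 := Finset.prod_eq_zero (Finset.mem_univ j) (h _ _ hpj hj)
  rw [h0, mul_zero]

/-- Multiplying every entry `M p j` of row `p` by `w j - v p`, and summing over `p`: each term of the
Leibniz expansion is multiplied by `∑ (w (σ p) - v p)`, which does not depend on `σ`. -/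
theorem Matrix.sum_det_updateRow {k : ℕ} (M : Matrix (Fin k) (Fin k) ℝ) (v w : Fin k → ℝ) :
    ∑ p, (M.updateRow p fun j => (w j - v p) * M p j).det = (∑ i, w i - ∑ i, v i) * M.det := by
  simp_rw [← Matrix.det_transpose M, ← Matrix.det_transpose (M.updateRow _ _), Matrix.det_apply']
  rw [Finset.sum_comm, Finset.mul_sum]
  refine Finset.sum_congr rfl fun σ _ => ?_
  have h : ∀ p, ∏ i, (M.updateRow p fun j => (w j - v p) * M p j).transpose (σ i) i =
      (w (σ p) - v p) * ∏ i, M.transpose (σ i) i := by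
    intro p
    rw [← Finset.mul_prod_erase _ _ (Finset.mem_univ p),
      ← Finset.mul_prod_erase _ (fun i => M.transpose (σ i) i) (Finset.mem_univ p)]
    simp only [Matrix.transpose_apply, Matrix.updateRow_self]
    rw [Finset.prod_congr rfl fun i hi => by
      rw [Matrix.updateRow_ne (Finset.ne_of_mem_erase hi)]]
    ring
  simp_rw [h]
  rw [← Finset.mul_sum, ← Finset.sum_mul, Finset.sum_sub_distrib, Equiv.sum_comp σ w]
  ring

/-- The entry in row `a` and column `b` of the exponential of `t` times the (infinite) matrix with
ones on the superdiagonal. -/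
noncomputable def expEntry (t : ℝ) (a b : ℕ) : ℝ :=
  if a ≤ b then t ^ (b - a) / ((b - a).factorial : ℝ) else 0

theorem expEntry_self (t : ℝ) (a : ℕ) : expEntry t a a = 1 := by simp [expEntry]

theorem expEntry_of_lt (t : ℝ) {a b : ℕ} (h : b < a) : expEntry t a b = 0 := by
  simp [expEntry, h]

theorem mul_expEntry_succ (t : ℝ) (a b : ℕ) :
    t * expEntry t (a + 1) b = ((b : ℝ) - a) * expEntry t a b := by
  rcases lt_trichotomy a b with h | rfl | h
  · obtain ⟨d, rfl⟩ := Nat.exists_eq_add_of_lt h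
    have h1 : a + d + 1 - (a + 1) = d := by omega
    have h2 : a + d + 1 - a = d + 1 := by omega
    have h3 : ((d : ℝ) + 1) ≠ 0 := by positivity
    simp only [expEntry, h1, h2, if_pos (show a + 1 ≤ a + d + 1 by omega),
      if_pos (show a ≤ a + d + 1 by omega), Nat.factorial_succ]
    push_cast
    field_simp
    ring
  · simp [expEntry]
  · rw [expEntry_of_lt t h, expEntry_of_lt t (by omega)]; simp

/-- The minor of the exponential matrix with rows `r` and columns `c`. -/
noncomputable def expMinor (t : ℝ) {k : ℕ} (r c : Fin k → ℕ) : ℝ :=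
  (Matrix.of fun i j => expEntry t (r i) (c j)).det

/-- The differential equation `t (d/dt) exp(te) = te exp(te)`, taken on minors, raises one row index
at a time. -/
theorem mul_sum_expMinor_update (t : ℝ) {k : ℕ} (r c : Fin k → ℕ) :
    t * ∑ p, expMinor t (Function.update r p (r p + 1)) c =
      (∑ i, (c i : ℝ) - ∑ i, (r i : ℝ)) * expMinor t r c := by
  rw [expMinor, ← Matrix.sum_det_updateRow _ (fun i => (r i : ℝ)) (fun i => (c i : ℝ)),
    Finset.mul_sum]
  refine Finset.sum_congr rfl fun p _ => ?_
  simp only [Matrix.of_apply, ← mul_expEntry_succ]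
  have h : (fun j => t * expEntry t (r p + 1) (c j)) =
    t • (fun j => expEntry t (r p + 1) (c j)) := rfl
  rw [h, Matrix.det_updateRow_smul, expMinor]
  congr 2
  ext i j
  by_cases hi : i = p
  · subst hi; simp
  · simp [Matrix.updateRow_ne hi, Function.update_of_ne hi]

theorem expMinor_eq_zero (t : ℝ) {k : ℕ} {r c : Fin k → ℕ} (hr : Monotone r) (hc : Monotone c)
    {p : Fin k} (hp : c p < r p) : expMinor t r c = 0 :=
  Matrix.det_eq_zero_of_zero_block _ p fun _ _ hi hj =>
    expEntry_of_lt t (((hc hj).trans_lt hp).trans_le (hr hi))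

theorem expMinor_self (t : ℝ) {k : ℕ} {r : Fin k → ℕ} (hr : StrictMono r) : expMinor t r r = 1 := by
  have h : (Matrix.of fun i j => expEntry t (r i) (r j)).IsUpperTriangular :=
    fun _ _ hij => expEntry_of_lt t (hr hij)
  rw [expMinor, Matrix.det_of_isUpperTriangular h]
  simp [expEntry_self]

/-- Raising `r p` by one, where `p` is the last index with `r p < c p`, keeps `r` strictly
increasing and below `c`. -/
theorem exists_update_strictMono {k : ℕ} {r c : Fin k → ℕ} (hr : StrictMono r) (hc : StrictMono c)
    (hrc : ∀ i, r i ≤ c i) (hne : r ≠ c) :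
    ∃ p, StrictMono (Function.update r p (r p + 1)) ∧
      ∀ i, Function.update r p (r p + 1) i ≤ c i := by
  have hS : (Finset.univ.filter fun i => r i < c i).Nonempty := by
    by_contra hcon
    rw [Finset.not_nonempty_iff_eq_empty, Finset.filter_eq_empty_iff] at hcon
    exact hne (funext fun i => le_antisymm (hrc i) (not_lt.1 (hcon (Finset.mem_univ i))))
  obtain ⟨p, hp, hmax⟩ := Finset.exists_max_image _ id hS
  have hp' : r p < c p := by simpa using hp
  refine ⟨p, fun i j hij => ?_, fun i => ?_⟩
  · rcases eq_or_ne i p with rfl | hi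
    · have hj : r j = c j := by
        by_contra h
        have := hmax j (by simpa using lt_of_le_of_ne (hrc j) h)
        exact absurd hij (not_lt.2 this)
      rw [Function.update_self, Function.update_of_ne hij.ne', hj]
      exact lt_of_le_of_lt hp' (hc hij)
    · rw [Function.update_of_ne hi]
      rcases eq_or_ne j p with rfl | hj
      · rw [Function.update_self]; exact (hr hij).trans (Nat.lt_succ_self _)
      · rw [Function.update_of_ne hj]; exact hr hij
  · rcases eq_or_ne i p with rfl | hi
    · simpa using hp'
    · rw [Function.update_of_ne hi]; exact hrc i

theorem StrictMono.monotone_update_succ {k : ℕ} {r : Fin k → ℕ} (hr : StrictMono r) (p : Fin k) :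
    Monotone (Function.update r p (r p + 1)) := by
  intro i j hij
  rcases hij.eq_or_lt with rfl | hij
  · rfl
  have := hr hij
  simp only [Function.update_apply]
  split_ifs with h1 h2 h2
  · rfl
  · rw [← h1]; omega
  · rw [← h2]; omega
  · omega

/-- The minors of `exp(te)` with `r ≤ c` are nonnegative for `t ≥ 0` and positive for `t > 0`, by
induction on `N = ∑ (c i - r i)`: in `mul_sum_expMinor_update` the summands either vanish or
have a smaller `N`. -/
theorem expMinor_nonneg_and_pos {t : ℝ} (ht : 0 ≤ t) {k : ℕ} {c : Fin k → ℕ} (hc : StrictMono c)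
    (N : ℕ) : ∀ r : Fin k → ℕ, StrictMono r → (∀ i, r i ≤ c i) → ∑ i, r i + N = ∑ i, c i →
      0 ≤ expMinor t r c ∧ (0 < t → 0 < expMinor t r c) := by
  induction N with
  | zero =>
    intro r hr hrc hN
    have : r = c := by
      funext i
      exact (Finset.sum_eq_sum_iff_of_le fun i _ => hrc i).1 (by simpa using hN) i
        (Finset.mem_univ i)
    subst this
    simp [expMinor_self t hr]
  | succ N ih =>
    intro r hr hrc hN
    have hsum : ∀ p, ∑ i, Function.update r p (r p + 1) i = ∑ i, r i + 1 := by
      intro p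
      rw [Finset.sum_update_of_mem (Finset.mem_univ p), ← Finset.add_sum_erase _ r
        (Finset.mem_univ p), Finset.sdiff_singleton_eq_erase]
      ring
    have key := mul_sum_expMinor_update t r c
    have hfac : (∑ i, (c i : ℝ) - ∑ i, (r i : ℝ)) = N + 1 := by
      have : (∑ i, (c i : ℝ)) = ∑ i, (r i : ℝ) + (N + 1) := by exact_mod_cast hN.symm
      rw [this]; ring
    have hnn : ∀ p, 0 ≤ expMinor t (Function.update r p (r p + 1)) c := by
      intro p
      by_cases hle : ∀ i, Function.update r p (r p + 1) i ≤ c i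
      · by_cases hinj : Function.Injective (Function.update r p (r p + 1))
        · exact (ih _ ((hr.monotone_update_succ p).strictMono_of_injective hinj) hle
            (by rw [hsum]; omega)).1
        · simp only [Function.Injective, not_forall] at hinj
          obtain ⟨i, j, hij, hne⟩ := hinj
          refine le_of_eq (Matrix.det_zero_of_row_eq hne ?_).symm
          ext l
          simp only [Matrix.of_apply, hij]
      · push Not at hle
        obtain ⟨i, hi⟩ := hle
        exact (expMinor_eq_zero t (hr.monotone_update_succ p) hc.monotone hi).ge
    have hne : r ≠ c := by rintro rfl; omega
    obtain ⟨p, hp, hpc⟩ := exists_update_strictMono hr hc hrc hne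
    rw [hfac] at key
    have hN0 : (0 : ℝ) < N + 1 := by positivity
    refine ⟨?_, fun htpos => ?_⟩
    · refine nonneg_of_mul_nonneg_right (a := (N : ℝ) + 1) ?_ hN0
      rw [← key]
      exact mul_nonneg ht (Finset.sum_nonneg fun p _ => hnn p)
    · refine pos_of_mul_pos_right (a := (N : ℝ) + 1) ?_ hN0.le
      rw [← key]
      exact mul_pos htpos (Finset.sum_pos' (fun p _ => hnn p)
        ⟨p, Finset.mem_univ p, (ih _ hp hpc (by rw [hsum]; omega)).2 htpos⟩)

/-- The matrix `exp(te)`, where `e` has ones on the superdiagonal. -/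
noncomputable def expShift (n : ℕ) (t : ℝ) : Matrix (Fin n) (Fin n) ℝ :=
  Matrix.of fun i j => expEntry t i j

theorem expShift_mem (n : ℕ) (t : ℝ) : expShift n t ∈ upperUnitriangular n :=
  ⟨fun i => expEntry_self t i, fun _ _ h => expEntry_of_lt t h⟩

theorem det_submatrix_expShift_pos {n k : ℕ} {t : ℝ} (ht : 0 < t) {r c : Fin k → Fin n}
    (hr : StrictMono r) (hc : StrictMono c) (hrc : ∀ i, r i ≤ c i) :
    0 < ((expShift n t).submatrix r c).det :=
  (expMinor_nonneg_and_pos ht.le (c := fun i => (c i : ℕ)) (fun _ _ h => hc h)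
    (∑ i, (c i : ℕ) - ∑ i, (r i : ℕ)) (fun i => (r i : ℕ)) (fun _ _ h => hr h) (fun i => hrc i)
    (Nat.add_sub_cancel' (Finset.sum_le_sum fun i _ => hrc i))).2 ht

theorem det_submatrix_eq_zero {n k : ℕ} {x : Matrix (Fin n) (Fin n) ℝ}
    (hx : x ∈ upperUnitriangular n) {r c : Fin k → Fin n}
    (hr : StrictMono r) (hc : StrictMono c) {p : Fin k} (hp : c p < r p) :
    (x.submatrix r c).det = 0 :=
  Matrix.det_eq_zero_of_zero_block _ p fun _ _ hi hj =>
    hx.2 _ _ (((hc.monotone hj).trans_lt hp).trans_le (hr.monotone hi))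

theorem det_submatrix_self {n k : ℕ} {x : Matrix (Fin n) (Fin n) ℝ}
    (hx : x ∈ upperUnitriangular n) {c : Fin k → Fin n} (hc : StrictMono c) :
    (x.submatrix c c).det = 1 := by
  have h : (x.submatrix c c).IsUpperTriangular := fun _ _ hij => hx.2 _ _ (hc hij)
  rw [Matrix.det_of_isUpperTriangular h]
  simp [hx.1]

theorem expShift_mem_unipotentNonneg (n : ℕ) {t : ℝ} (ht : 0 ≤ t) :
    expShift n t ∈ unipotentNonneg n := by
  refine ⟨expShift_mem n t, fun k r c hr hc => ?_⟩
  by_cases hrc : ∀ i, r i ≤ c i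
  · exact (expMinor_nonneg_and_pos ht (c := fun i => (c i : ℕ)) (fun _ _ h => hc h)
      (∑ i, (c i : ℕ) - ∑ i, (r i : ℕ)) (fun i => (r i : ℕ)) (fun _ _ h => hr h) (fun i => hrc i)
      (Nat.add_sub_cancel' (Finset.sum_le_sum fun i _ => hrc i))).1
  · push Not at hrc
    obtain ⟨p, hp⟩ := hrc
    exact (det_submatrix_eq_zero (expShift_mem n t) hr hc hp).ge

/-- The matrices whose minors are positive, except for those that vanish on all upper-triangular
matrices. The order `k` is at most `n` whenever `r` is strictly increasing; bounding it in the
definition makes the condition a finite one, hence open. -/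
def minorsPos (n : ℕ) : Set (Matrix (Fin n) (Fin n) ℝ) :=
  {x | ∀ (k : Fin (n + 1)) (r c : Fin k → Fin n), StrictMono r → StrictMono c → (∀ i, r i ≤ c i) →
    0 < (x.submatrix r c).det}

theorem mem_unipotentNonneg_of_minorsPos {n : ℕ} {x : Matrix (Fin n) (Fin n) ℝ}
    (hx : x ∈ upperUnitriangular n) (hpos : x ∈ minorsPos n) : x ∈ unipotentNonneg n := by
  refine ⟨hx, fun k r c hr hc => ?_⟩
  have hk : k < n + 1 := Nat.lt_succ_of_le (by
    simpa using Fintype.card_le_of_injective r hr.injective)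
  by_cases hrc : ∀ i, r i ≤ c i
  · exact (hpos ⟨k, hk⟩ r c hr hc hrc).le
  · push Not at hrc
    obtain ⟨p, hp⟩ := hrc
    exact (det_submatrix_eq_zero hx hr hc hp).ge

theorem isOpen_minorsPos (n : ℕ) : IsOpen (minorsPos n) := by
  simp only [minorsPos, Set.ofPred_forall]
  refine isOpen_iInter_of_finite fun k => isOpen_iInter_of_finite fun r =>
    isOpen_iInter_of_finite fun c => isOpen_iInter_of_finite fun _ =>
    isOpen_iInter_of_finite fun _ => isOpen_iInter_of_finite fun _ => ?_
  exact isOpen_lt continuous_const (continuous_id.matrix_submatrix r c).matrix_det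

/-- In the Cauchy–Binet formula for the minor with rows `r` and columns `c`, all summands are
nonnegative, and the one that selects `c` is the minor `(r, c)` of `exp(te)` times
the minor `(c, c)` of `z`, which is `1`. -/
theorem expShift_mul_mem_minorsPos {n : ℕ} {t : ℝ} (ht : 0 < t) {z : Matrix (Fin n) (Fin n) ℝ}
    (hz : z ∈ unipotentNonneg n) : expShift n t * z ∈ minorsPos n := by
  intro k r c hr hc hrc
  have hE := expShift_mem_unipotentNonneg n ht.le
  have h := Matrix.factorial_mul_det_mul ((expShift n t).submatrix r id) (z.submatrix id c)
  have hmul : (expShift n t).submatrix r id * z.submatrix id c =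
      (expShift n t * z).submatrix r c := by
    ext i j; simp [Matrix.mul_apply]
  rw [hmul] at h
  refine pos_of_mul_pos_right (a := ((k : ℕ).factorial : ℝ)) ?_ (by positivity)
  rw [h]
  refine Finset.sum_pos' (fun f _ => hE.2.det_mul_det_nonneg hz.2 hr hc f)
    ⟨c, Finset.mem_univ c, ?_⟩
  have h1 := det_submatrix_expShift_pos ht hr hc hrc
  have h2 := det_submatrix_self hz.1 hc
  simp only [Matrix.submatrix_submatrix, Function.comp_id, Function.id_comp]
  rw [h2, mul_one]
  exact h1

/-! ### The unipotent group and its dilations -/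

theorem mul_mem_upperUnitriangular {n : ℕ} {x y : Matrix (Fin n) (Fin n) ℝ}
    (hx : x ∈ upperUnitriangular n) (hy : y ∈ upperUnitriangular n) :
    x * y ∈ upperUnitriangular n := by
  refine ⟨fun i => ?_, fun i j hji => ?_⟩
  · rw [Matrix.mul_apply, Finset.sum_eq_single i, hx.1, hy.1, one_mul]
    · intro k _ hk
      rcases lt_or_gt_of_ne hk with h | h
      · rw [hx.2 _ _ h, zero_mul]
      · rw [hy.2 _ _ h, mul_zero]
    · simp
  · rw [Matrix.mul_apply]
    refine Finset.sum_eq_zero fun k _ => ?_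
    rcases lt_or_ge k i with h | h
    · rw [hx.2 _ _ h, zero_mul]
    · rw [hy.2 _ _ (hji.trans_le h), mul_zero]

theorem sum_expEntry_mul (a b : ℝ) {n i j : ℕ} (hj : j < n) :
    ∑ k ∈ Finset.range n, expEntry a i k * expEntry b k j = expEntry (a + b) i j := by
  rcases lt_or_ge j i with hji | hij
  · rw [expEntry_of_lt _ hji]
    refine Finset.sum_eq_zero fun k _ => ?_
    rcases lt_or_ge k i with h | h
    · rw [expEntry_of_lt _ h, zero_mul]
    · rw [expEntry_of_lt _ (hji.trans_le h), mul_zero]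
  · obtain ⟨d, rfl⟩ := Nat.exists_eq_add_of_le hij
    have h1 : ∑ k ∈ Finset.range n, expEntry a i k * expEntry b k (i + d) =
        ∑ k ∈ Finset.Ico i (i + d + 1), expEntry a i k * expEntry b k (i + d) := by
      symm
      refine Finset.sum_subset (fun k hk => ?_) fun k _ hk => ?_
      · rw [Finset.mem_Ico] at hk; rw [Finset.mem_range]; omega
      · rw [Finset.mem_Ico, not_and_or] at hk
        rcases hk with h | h
        · rw [expEntry_of_lt _ (by omega), zero_mul]
        · rw [expEntry_of_lt _ (by omega : i + d < k), mul_zero]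
    rw [h1, Finset.sum_Ico_eq_sum_range, show i + d + 1 - i = d + 1 by omega]
    simp only [expEntry, if_pos hij, Nat.add_sub_cancel_left, add_pow, Finset.sum_div]
    refine Finset.sum_congr rfl fun m hm => ?_
    have hmd : m ≤ d := Nat.lt_succ_iff.1 (Finset.mem_range.1 hm)
    rw [if_pos (Nat.le_add_right i m), if_pos (by omega), show i + d - (i + m) = d - m by omega,
      ← Nat.choose_mul_factorial_mul_factorial hmd]
    have := Nat.choose_pos hmd
    push_cast
    field_simp

theorem expShift_mul_expShift (n : ℕ) (a b : ℝ) :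
    expShift n a * expShift n b = expShift n (a + b) := by
  ext i j
  rw [Matrix.mul_apply]
  exact (Fin.sum_univ_eq_sum_range (fun k => expEntry a i k * expEntry b k j) n).trans
    (sum_expEntry_mul a b j.2)

theorem expShift_zero (n : ℕ) : expShift n 0 = 1 := by
  ext i j
  rcases lt_trichotomy i j with h | rfl | h
  · rw [Matrix.one_apply_ne h.ne]
    have h' : (i : ℕ) < j := h
    simp [expShift, expEntry, (Nat.sub_pos_of_lt h').ne']
  · simp [expShift, expEntry_self]
  · rw [Matrix.one_apply_ne h.ne']
    exact (expShift_mem n 0).2 _ _ h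

/-- The dilation by `s`, which multiplies the `d`-th superdiagonal by `s ^ d`. For `s ≠ 0` it is, on
upper-triangular matrices, the conjugation by a diagonal matrix. -/
def dilate {n : ℕ} (s : ℝ) (x : Matrix (Fin n) (Fin n) ℝ) : Matrix (Fin n) (Fin n) ℝ :=
  Matrix.of fun i j => s ^ ((j : ℕ) - i) * x i j

theorem dilate_apply {n : ℕ} (s : ℝ) (x : Matrix (Fin n) (Fin n) ℝ) (i j : Fin n) :
    dilate s x i j = s ^ ((j : ℕ) - i) * x i j := rfl

theorem dilate_mem {n : ℕ} (s : ℝ) {x : Matrix (Fin n) (Fin n) ℝ}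
    (hx : x ∈ upperUnitriangular n) : dilate s x ∈ upperUnitriangular n :=
  ⟨fun i => by simp [dilate_apply, hx.1], fun i j h => by simp [dilate_apply, hx.2 i j h]⟩

theorem dilate_dilate {n : ℕ} (s r : ℝ) (x : Matrix (Fin n) (Fin n) ℝ) :
    dilate s (dilate r x) = dilate (s * r) x := by
  ext i j; simp [dilate_apply, mul_pow, mul_assoc]

theorem dilate_one {n : ℕ} (x : Matrix (Fin n) (Fin n) ℝ) : dilate 1 x = x := by
  ext i j; simp [dilate_apply]

theorem dilate_zero {n : ℕ} {x : Matrix (Fin n) (Fin n) ℝ} (hx : x ∈ upperUnitriangular n) :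
    dilate 0 x = 1 := by
  ext i j
  rcases lt_trichotomy i j with h | rfl | h
  · have h' : (i : ℕ) < j := h
    simp [dilate_apply, Matrix.one_apply_ne h.ne, (Nat.sub_pos_of_lt h').ne']
  · simp [dilate_apply, hx.1]
  · rw [Matrix.one_apply_ne h.ne', (dilate_mem 0 hx).2 _ _ h]

theorem dilate_mul {n : ℕ} (s : ℝ) {x y : Matrix (Fin n) (Fin n) ℝ}
    (hx : x ∈ upperUnitriangular n) (hy : y ∈ upperUnitriangular n) :
    dilate s (x * y) = dilate s x * dilate s y := by
  ext i j
  rw [dilate_apply, Matrix.mul_apply, Matrix.mul_apply, Finset.mul_sum]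
  refine Finset.sum_congr rfl fun k _ => ?_
  rw [dilate_apply, dilate_apply]
  rcases lt_or_ge k i with h | h
  · simp [hx.2 _ _ h]
  rcases lt_or_ge j k with h2 | h2
  · simp [hy.2 _ _ h2]
  have h1' : (i : ℕ) ≤ k := h
  have h2' : (k : ℕ) ≤ j := h2
  rw [show (j : ℕ) - i = (k - i) + (j - k) by omega, pow_add]
  ring

theorem dilate_expShift (n : ℕ) (s t : ℝ) : dilate s (expShift n t) = expShift n (s * t) := by
  ext i j
  simp only [dilate_apply, expShift, Matrix.of_apply, expEntry, mul_pow]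
  split_ifs
  · ring
  · simp

theorem continuous_dilate {n : ℕ} :
    Continuous fun p : ℝ × Matrix (Fin n) (Fin n) ℝ => dilate p.1 p.2 :=
  continuous_matrix fun i j => (continuous_fst.pow _).mul (continuous_snd.matrix_elem i j)

/-- For `s > 0` the dilation multiplies a minor by a power of `s`, namely by
`s ^ (∑ c - ∑ r)`. -/
theorem dilate_mem_unipotentNonneg {n : ℕ} {s : ℝ} (hs : 0 ≤ s) {x : Matrix (Fin n) (Fin n) ℝ}
    (hx : x ∈ unipotentNonneg n) : dilate s x ∈ unipotentNonneg n := by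
  rcases hs.eq_or_lt with rfl | hs
  · rw [dilate_zero hx.1, ← expShift_zero]
    exact expShift_mem_unipotentNonneg n le_rfl
  refine ⟨dilate_mem s hx.1, fun k r c hr hc => ?_⟩
  have h : (dilate s x).submatrix r c = Matrix.of fun a b => (s ^ (r a : ℕ))⁻¹ *
      (Matrix.of fun a b => s ^ (c b : ℕ) * x.submatrix r c a b) a b := by
    ext a b
    simp only [Matrix.submatrix_apply, dilate_apply, Matrix.of_apply]
    rcases lt_or_ge (c b) (r a) with h | h
    · simp [hx.1.2 _ _ h]
    · rw [pow_sub₀ _ hs.ne' h]; ring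
  rw [h, Matrix.det_mul_column, Matrix.det_mul_row]
  exact mul_nonneg (Finset.prod_nonneg fun _ _ => by positivity)
    (mul_nonneg (Finset.prod_nonneg fun _ _ => by positivity) (hx.2 k r c hr hc))

/-! ### Compactness of the link -/

/-- The sum of the superdiagonal entries. -/
def superdiagSum {n : ℕ} (x : Matrix (Fin n) (Fin n) ℝ) : ℝ :=
  ∑ i : Fin (n - 1), x ⟨i, by omega⟩ ⟨i + 1, by omega⟩

theorem mem_linkNonneg {n : ℕ} {x : Matrix (Fin n) (Fin n) ℝ} :
    x ∈ linkNonneg n ↔ x ∈ unipotentNonneg n ∧ superdiagSum x = (n : ℝ) - 1 := Iff.rfl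

theorem continuous_superdiagSum {n : ℕ} :
    Continuous (superdiagSum : Matrix (Fin n) (Fin n) ℝ → ℝ) :=
  continuous_finsetSum _ fun _ _ => continuous_id.matrix_elem _ _

theorem superdiagSum_dilate {n : ℕ} (s : ℝ) (x : Matrix (Fin n) (Fin n) ℝ) :
    superdiagSum (dilate s x) = s * superdiagSum x := by
  simp [superdiagSum, dilate_apply, Finset.mul_sum]

theorem superdiagSum_mul {n : ℕ} {x y : Matrix (Fin n) (Fin n) ℝ}
    (hx : x ∈ upperUnitriangular n) (hy : y ∈ upperUnitriangular n) :
    superdiagSum (x * y) = superdiagSum x + superdiagSum y := by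
  rw [superdiagSum, superdiagSum, superdiagSum, ← Finset.sum_add_distrib]
  refine Finset.sum_congr rfl fun i _ => ?_
  rw [Matrix.mul_apply, Finset.sum_eq_add (⟨i, by omega⟩ : Fin n) ⟨i + 1, by omega⟩]
  · rw [hx.1, hy.1]; ring
  · simp
  · intro k _ hk
    rw [Ne, Fin.ext_iff, Ne, Fin.ext_iff] at hk
    rcases lt_or_ge (k : ℕ) i with h | h
    · rw [hx.2 _ _ (Fin.lt_def.2 h), zero_mul]
    · rw [hy.2 _ _ (Fin.lt_def.2 (by simp only at hk ⊢; omega)), mul_zero]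
  · simp
  · simp

theorem superdiagSum_expShift {n : ℕ} (hn : 1 ≤ n) (t : ℝ) :
    superdiagSum (expShift n t) = ((n : ℝ) - 1) * t := by
  simp [superdiagSum, expShift, expEntry, Nat.cast_sub hn]

theorem entry_nonneg {n : ℕ} {x : Matrix (Fin n) (Fin n) ℝ} (hx : x ∈ unipotentNonneg n)
    (i j : Fin n) : 0 ≤ x i j := by
  have h := hx.2 1 (fun _ => i) (fun _ => j) (Subsingleton.strictMono _) (Subsingleton.strictMono _)
  simpa using h

theorem superdiagSum_nonneg {n : ℕ} {x : Matrix (Fin n) (Fin n) ℝ} (hx : x ∈ unipotentNonneg n) :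
    0 ≤ superdiagSum x :=
  Finset.sum_nonneg fun _ _ => entry_nonneg hx _ _

/-- The `2 × 2` minor with rows `i, k` and columns `k, j` is `x i k * x k j - x i j`. -/
theorem entry_le_mul {n : ℕ} {x : Matrix (Fin n) (Fin n) ℝ} (hx : x ∈ unipotentNonneg n)
    {i k j : Fin n} (hik : i < k) (hkj : k < j) : x i j ≤ x i k * x k j := by
  have h := hx.2 2 ![i, k] ![k, j] (by simp [Fin.strictMono_iff_lt_succ, hik])
    (by simp [Fin.strictMono_iff_lt_succ, hkj])
  rw [Matrix.det_fin_two] at h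
  simp [hx.1.1] at h
  exact h

theorem entry_le_superdiagSum_pow {n : ℕ} {x : Matrix (Fin n) (Fin n) ℝ}
    (hx : x ∈ unipotentNonneg n) (d : ℕ) :
    ∀ i j : Fin n, (i : ℕ) + d = j → x i j ≤ superdiagSum x ^ d := by
  have hsup : ∀ i j : Fin n, (i : ℕ) + 1 = j → x i j ≤ superdiagSum x := by
    intro i j hij
    have hi : (i : ℕ) < n - 1 := by omega
    have h := Finset.single_le_sum (f := fun i : Fin (n - 1) =>
      x ⟨i, by omega⟩ ⟨i + 1, by omega⟩) (fun i _ => entry_nonneg hx _ _)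
      (Finset.mem_univ (⟨i, hi⟩ : Fin (n - 1)))
    have hj : j = ⟨i + 1, by omega⟩ := Fin.ext hij.symm
    rw [hj]
    exact h
  induction d with
  | zero =>
    intro i j hij
    obtain rfl : i = j := Fin.ext hij
    simp [hx.1.1]
  | succ d ih =>
    intro i j hij
    rcases Nat.eq_zero_or_pos d with rfl | hd
    · simpa using hsup i j hij
    · have hk : (i : ℕ) + 1 < n := by omega
      refine (entry_le_mul hx (k := ⟨i + 1, hk⟩) (Fin.lt_def.2 (by simp))
        (Fin.lt_def.2 (by simp only; omega))).trans ?_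
      rw [pow_succ']
      exact mul_le_mul (hsup _ _ rfl) (ih _ _ (by simp only; omega)) (entry_nonneg hx _ _)
        (superdiagSum_nonneg hx)

theorem eq_one_of_superdiagSum_eq_zero {n : ℕ} {x : Matrix (Fin n) (Fin n) ℝ}
    (hx : x ∈ unipotentNonneg n) (h0 : superdiagSum x = 0) : x = 1 := by
  ext i j
  rcases lt_trichotomy i j with h | rfl | h
  · have h' : (i : ℕ) < j := h
    have := entry_le_superdiagSum_pow hx (j - i) i j (by omega)
    rw [h0, zero_pow (by omega)] at this
    rw [Matrix.one_apply_ne h.ne]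
    exact le_antisymm this (entry_nonneg hx i j)
  · rw [hx.1.1, Matrix.one_apply_eq]
  · rw [hx.1.2 _ _ h, Matrix.one_apply_ne h.ne']

theorem isClosed_upperUnitriangular (n : ℕ) : IsClosed (upperUnitriangular n) := by
  simp only [upperUnitriangular, Set.ofPred_and, Set.ofPred_forall]
  refine IsClosed.inter (isClosed_iInter fun i => ?_)
    (isClosed_iInter fun i => isClosed_iInter fun j => isClosed_iInter fun _ => ?_)
  · exact isClosed_eq (continuous_id.matrix_elem i i) continuous_const
  · exact isClosed_eq (continuous_id.matrix_elem i j) continuous_const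

theorem isClosed_unipotentNonneg (n : ℕ) : IsClosed (unipotentNonneg n) := by
  suffices h : IsClosed {x : Matrix (Fin n) (Fin n) ℝ | IsTotallyNonneg x} from
    (isClosed_upperUnitriangular n).inter h
  simp only [IsTotallyNonneg, Set.ofPred_forall]
  refine isClosed_iInter fun k => isClosed_iInter fun r => isClosed_iInter fun c =>
    isClosed_iInter fun _ => isClosed_iInter fun _ => ?_
  exact isClosed_le continuous_const (continuous_id.matrix_submatrix r c).matrix_det

theorem isCompact_linkNonneg (n : ℕ) : IsCompact (linkNonneg n) := by
  have hcpt : IsCompact (Set.univ.pi fun i : Fin n => Set.univ.pi fun j : Fin n =>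
      Set.Icc (0 : ℝ) (((n : ℝ) - 1) ^ ((j : ℕ) - i))) :=
    isCompact_univ_pi fun _ => isCompact_univ_pi fun _ => isCompact_Icc
  refine hcpt.of_isClosed_subset
    ((isClosed_unipotentNonneg n).inter (isClosed_eq continuous_superdiagSum continuous_const)) ?_
  rintro x ⟨hx, hsum⟩ i - j -
  refine ⟨entry_nonneg hx i j, ?_⟩
  rcases le_or_gt i j with h | h
  · have h' : (i : ℕ) ≤ j := h
    have := entry_le_superdiagSum_pow hx (j - i) i j (by omega)
    rwa [show superdiagSum x = (n : ℝ) - 1 from hsum] at this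
  · have h' : (j : ℕ) < i := h
    simp [hx.1.2 _ _ h, Nat.sub_eq_zero_of_le h'.le]

/-! ### The contracting flow -/

/-- Two forms of the flow: on the left it is conjugate to a dilation, on the right it visibly
preserves total nonnegativity for `0 ≤ s ≤ 1`. -/
theorem expShift_mul_dilate {n : ℕ} (s : ℝ) {x : Matrix (Fin n) (Fin n) ℝ}
    (hx : x ∈ upperUnitriangular n) :
    expShift n 1 * dilate s (expShift n (-1) * x) = expShift n (1 - s) * dilate s x := by
  rw [dilate_mul s (expShift_mem n _) hx, dilate_expShift, ← mul_assoc, expShift_mul_expShift]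
  ring_nf

theorem expShift_mul_cancel {n : ℕ} (t : ℝ) (x : Matrix (Fin n) (Fin n) ℝ) :
    expShift n t * (expShift n (-t) * x) = x := by
  rw [← mul_assoc, expShift_mul_expShift, add_neg_cancel, expShift_zero, one_mul]

/-! ### Compact sets that scalars contract into their interior -/

section Gauge

variable {E : Type*} [NormedAddCommGroup E] [NormedSpace ℝ E] {K : Set E}

/-- If `s • K ⊆ interior K` for `0 ≤ s < 1`, the closed sublevel sets of the gauge of `K` are
dilates of `K`, although `K` need not be convex. -/
theorem gauge_le_iff_of_smul_mem_interior (hK : IsCompact K) (hne : K.Nonempty)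
    (hstar : ∀ y ∈ K, ∀ s : ℝ, 0 ≤ s → s < 1 → s • y ∈ interior K) {a : ℝ} (ha : 0 < a) (y : E) :
    gauge K y ≤ a ↔ a⁻¹ • y ∈ K := by
  have h0 : (0 : E) ∈ interior K := by
    obtain ⟨y, hy⟩ := hne
    simpa using hstar y hy 0 le_rfl one_pos
  have habs : Absorbent ℝ K := absorbent_nhds_zero (mem_interior_iff_mem_nhds.1 h0)
  constructor
  · intro h
    -- `b⁻¹ • y ∈ K` for all `b > a`, and `K` is closed
    have hb : ∀ b, a < b → b⁻¹ • y ∈ K := by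
      intro b hb
      obtain ⟨b', hb', hlt, hy⟩ := exists_lt_of_gauge_lt habs (h.trans_lt hb)
      obtain ⟨z, hz, rfl⟩ := hy
      have hbpos : 0 < b := ha.trans hb
      have := hstar z hz (b⁻¹ * b') (by positivity) (by
        rw [inv_mul_lt_iff₀ hbpos]; simpa using hlt)
      simpa [smul_smul] using interior_subset this
    have htend : Filter.Tendsto (fun b : ℝ => b⁻¹ • y) (𝓝[>] a) (𝓝 (a⁻¹ • y)) :=
      (((continuousAt_inv₀ ha.ne').smul continuousAt_const).tendsto).mono_left nhdsWithin_le_nhds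
    exact hK.isClosed.mem_of_tendsto htend
      (Filter.eventually_of_mem self_mem_nhdsWithin fun b hb' => hb b hb')
  · intro h
    exact gauge_le_of_mem ha.le ((Set.mem_smul_set_iff_inv_smul_mem₀ ha.ne' _ _).2 h)

theorem gauge_lt_iff_of_smul_mem_interior (hne : K.Nonempty)
    (hstar : ∀ y ∈ K, ∀ s : ℝ, 0 ≤ s → s < 1 → s • y ∈ interior K) {a : ℝ} (ha : 0 < a) (y : E) :
    gauge K y < a ↔ a⁻¹ • y ∈ interior K := by
  have h0 : (0 : E) ∈ interior K := by
    obtain ⟨y, hy⟩ := hne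
    simpa using hstar y hy 0 le_rfl one_pos
  have habs : Absorbent ℝ K := absorbent_nhds_zero (mem_interior_iff_mem_nhds.1 h0)
  constructor
  · intro h
    obtain ⟨b, hb, hlt, z, hz, rfl⟩ := exists_lt_of_gauge_lt habs h
    have := hstar z hz (a⁻¹ * b) (by positivity) (by
      rw [inv_mul_lt_iff₀ ha]; simpa using hlt)
    simpa [smul_smul] using this
  · intro h
    have := interior_subset_gauge_lt_one K h
    rw [Set.mem_ofPred_eq, gauge_smul_of_nonneg (by positivity), smul_eq_mul,
      inv_mul_lt_iff₀ ha] at this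
    simpa using this

theorem continuous_gauge_of_smul_mem_interior (hK : IsCompact K) (hne : K.Nonempty)
    (hstar : ∀ y ∈ K, ∀ s : ℝ, 0 ≤ s → s < 1 → s • y ∈ interior K) : Continuous (gauge K) := by
  refine continuous_iff_continuousAt.2 fun x => tendsto_order.2 ⟨fun a hax => ?_, fun a hax => ?_⟩
  · rcases lt_or_ge a 0 with ha | ha
    · exact Filter.Eventually.of_forall fun y => ha.trans_le (gauge_nonneg y)
    obtain ⟨b, hab, hbx⟩ := exists_between hax
    have hb : 0 < b := ha.trans_lt hab
    have hx : b⁻¹ • x ∈ Kᶜ := fun h =>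
      hbx.not_ge ((gauge_le_iff_of_smul_mem_interior hK hne hstar hb x).2 h)
    filter_upwards [(continuous_const_smul b⁻¹).continuousAt.preimage_mem_nhds
      (hK.isClosed.isOpen_compl.mem_nhds hx)] with y hy
    exact hab.trans (not_le.1 fun h =>
      hy ((gauge_le_iff_of_smul_mem_interior hK hne hstar hb y).1 h))
  · have ha : 0 < a := (gauge_nonneg x).trans_lt hax
    have hx := (gauge_lt_iff_of_smul_mem_interior hne hstar ha x).1 hax
    filter_upwards [(continuous_const_smul a⁻¹).continuousAt.preimage_mem_nhds
      (isOpen_interior.mem_nhds hx)] with y hy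
    exact (gauge_lt_iff_of_smul_mem_interior hne hstar ha y).2 hy

/-- The map that rescales every ray by the gauge of `K` carries `K` onto the closed unit ball. -/
theorem nonempty_homeomorph_closedBall (hK : IsCompact K) (hne : K.Nonempty)
    (hstar : ∀ y ∈ K, ∀ s : ℝ, 0 ≤ s → s < 1 → s • y ∈ interior K) :
    Nonempty (K ≃ₜ Metric.closedBall (0 : E) 1) := by
  have h0 : (0 : E) ∈ interior K := by
    obtain ⟨y, hy⟩ := hne
    simpa using hstar y hy 0 le_rfl one_pos
  have h0' : K ∈ 𝓝 (0 : E) := mem_interior_iff_mem_nhds.1 h0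
  have hKa : Absorbent ℝ K := absorbent_nhds_zero h0'
  have hKb : Bornology.IsVonNBounded ℝ K := NormedSpace.isVonNBounded_of_isBounded ℝ hK.isBounded
  have hB0 : Metric.ball (0 : E) 1 ∈ 𝓝 (0 : E) := Metric.ball_mem_nhds 0 one_pos
  have hBa : Absorbent ℝ (Metric.ball (0 : E) 1) := absorbent_nhds_zero hB0
  have hBb : Bornology.IsVonNBounded ℝ (Metric.ball (0 : E) 1) :=
    NormedSpace.isVonNBounded_ball ℝ E 1
  let e : E ≃ E := gaugeRescaleEquiv K (Metric.ball 0 1) hKa hKb hBa hBb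
  have hnorm : ∀ y, ‖e y‖ = gauge K y := fun y => by
    rw [← gauge_unit_ball]; exact gauge_gaugeRescale K hBa hBb y
  have hmem : ∀ y, y ∈ K ↔ e y ∈ Metric.closedBall (0 : E) 1 := fun y => by
    rw [mem_closedBall_zero_iff, hnorm, gauge_le_iff_of_smul_mem_interior hK hne hstar one_pos,
      inv_one, one_smul]
  have hg := continuous_gauge_of_smul_mem_interior hK hne hstar
  have hcont : Continuous e := by
    refine continuous_iff_continuousAt.2 fun x => ?_
    rcases eq_or_ne x 0 with rfl | hx
    · have he0 : e 0 = 0 := gaugeRescale_zero _ _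
      rw [ContinuousAt, he0, tendsto_zero_iff_norm_tendsto_zero]
      simp only [hnorm]
      simpa using hg.tendsto 0
    · have h : (e : E → E) = fun x => (gauge K x / ‖x‖) • x := by
        funext x
        change gaugeRescale _ _ x = _
        rw [gaugeRescale_def, gauge_unit_ball]
      rw [h]
      exact (hg.continuousAt.div continuousAt_id.norm (norm_ne_zero_iff.2 hx)).smul continuousAt_id
  have : CompactSpace K := isCompact_iff_compactSpace.1 hK
  let e' : K ≃ Metric.closedBall (0 : E) 1 := e.subtypeEquiv hmem
  have he' : Continuous e' := (hcont.comp continuous_subtype_val).subtype_mk _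
  exact ⟨he'.homeoOfEquivCompactToT2⟩

end Gauge

/-- The form of `nonempty_homeomorph_closedBall` in which the ambient space has only been identified
up to dimension with a Euclidean space. -/
theorem nonempty_homeomorph_closedBall_euclidean {E : Type*} [NormedAddCommGroup E]
    [NormedSpace ℝ E] [FiniteDimensional ℝ E] {K : Set E} {m : ℕ} (hm : Module.finrank ℝ E = m)
    (hK : IsCompact K) (hne : K.Nonempty)
    (hstar : ∀ y ∈ K, ∀ s : ℝ, 0 ≤ s → s < 1 → s • y ∈ interior K) :
    Nonempty (K ≃ₜ Metric.closedBall (0 : EuclideanSpace ℝ (Fin m)) 1) := by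
  let φ : E ≃L[ℝ] EuclideanSpace ℝ (Fin m) :=
    ContinuousLinearEquiv.ofFinrankEq (by rw [hm, finrank_euclideanSpace_fin])
  obtain ⟨f⟩ := nonempty_homeomorph_closedBall (hK.image φ.continuous) (hne.image φ) (by
    rintro _ ⟨y, hy, rfl⟩ s hs hs1
    rw [← map_smul]
    have := φ.toHomeomorph.image_interior K
    exact this ▸ Set.mem_image_of_mem φ (hstar y hy s hs hs1))
  exact ⟨(φ.toHomeomorph.image K).trans f⟩

/-- A closed half-space is homeomorphic to the cone over the closed unit ball: the map
`(s, w) ↦ (s - ‖w‖, w)` straightens the cone `‖w‖ ≤ s`. -/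
theorem nonempty_homeomorph_closedHalfSpace {N : ℕ} (hN : 0 < N) :
    Nonempty ({p : ℝ × EuclideanSpace ℝ (Fin (N - 1)) | ‖p.2‖ ≤ p.1} ≃ₜ
      closedHalfSpace (N := N) ⟨0, hN⟩) := by
  obtain ⟨m, rfl⟩ : ∃ m, N = m + 1 := ⟨N - 1, by omega⟩
  exact ⟨{
    toFun := fun p => ⟨WithLp.toLp 2 (Fin.cons (p.1.1 - ‖p.1.2‖) (WithLp.ofLp p.1.2)), by
      have h : ‖p.1.2‖ ≤ p.1.1 := p.2
      simpa [closedHalfSpace] using h⟩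
    invFun := fun y => ⟨(y.1 0 + ‖WithLp.toLp 2 (fun i : Fin m => y.1 i.succ)‖,
        WithLp.toLp 2 (fun i : Fin m => y.1 i.succ)), by
      have h : 0 ≤ y.1 0 := y.2
      simpa using h⟩
    left_inv := fun p => by
      apply Subtype.ext
      refine Prod.ext ?_ ?_ <;> simp
    right_inv := fun y => by
      apply Subtype.ext
      ext i
      refine Fin.cases ?_ (fun i => ?_) i <;> simp
    continuous_toFun := by
      refine Continuous.subtype_mk ?_ _
      refine (PiLp.continuous_toLp 2 _).comp ?_
      refine Continuous.finCons ?_ ?_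
      · fun_prop
      · fun_prop
    continuous_invFun := by
      refine Continuous.subtype_mk ?_ _
      fun_prop }⟩

/-! ### Linear coordinates for the flow -/

/-- The signed power `t ↦ t |t| ^ d`, an odd homeomorphism of the line that is homogeneous of degree
`d + 1`. -/
def signedPow (d : ℕ) (t : ℝ) : ℝ := t * |t| ^ d

theorem signedPow_neg (d : ℕ) (t : ℝ) : signedPow d (-t) = -signedPow d t := by
  simp [signedPow]

theorem signedPow_mul (d : ℕ) {s : ℝ} (hs : 0 ≤ s) (t : ℝ) :
    signedPow d (s * t) = s ^ (d + 1) * signedPow d t := by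
  rw [signedPow, signedPow, abs_mul, abs_of_nonneg hs, mul_pow, pow_succ]
  ring

theorem strictMono_signedPow (d : ℕ) : StrictMono (signedPow d) := by
  refine strictMono_of_odd_strictMonoOn_nonneg (signedPow_neg d) fun a ha b hb hab => ?_
  rw [signedPow, signedPow, abs_of_nonneg ha, abs_of_nonneg hb, ← pow_succ', ← pow_succ']
  exact pow_lt_pow_left₀ hab ha d.succ_ne_zero

theorem signedPow_surjective (d : ℕ) : Function.Surjective (signedPow d) := by
  have h : ∀ y : ℝ, 0 ≤ y → ∃ t, signedPow d t = y := fun y hy =>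
    ⟨y ^ (((d + 1 : ℕ) : ℝ)⁻¹), by
      rw [signedPow, abs_of_nonneg (by positivity), ← pow_succ',
        Real.rpow_inv_natCast_pow hy d.succ_ne_zero]⟩
  intro y
  rcases le_total 0 y with hy | hy
  · exact h y hy
  · obtain ⟨t, ht⟩ := h (-y) (neg_nonneg.2 hy)
    exact ⟨-t, by rw [signedPow_neg, ht, neg_neg]⟩

/-- `signedPow` as a homeomorphism of the line. -/
noncomputable def signedPowHomeo (d : ℕ) : ℝ ≃ₜ ℝ :=
  ((strictMono_signedPow d).orderIsoOfSurjective _ (signedPow_surjective d)).toHomeomorph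

/-- The positions above the diagonal, which are the coordinates on the unipotent group. -/
abbrev AboveDiag (n : ℕ) : Type := {p : Fin n × Fin n // p.1 < p.2}

theorem card_aboveDiag (n : ℕ) : Fintype.card (AboveDiag n) = n.choose 2 := by
  have e : AboveDiag n ≃ (j : Fin n) × Fin j :=
    { toFun := fun p => ⟨p.1.2, ⟨p.1.1, p.2⟩⟩
      invFun := fun q => ⟨(⟨q.2, q.2.2.trans q.1.2⟩, q.1), q.2.2⟩
      left_inv := fun _ => rfl
      right_inv := fun _ => rfl }
  rw [Fintype.card_congr e, Fintype.card_sigma]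
  simp only [Fintype.card_fin]
  rw [Fin.sum_univ_eq_sum_range (fun i => i) n, Finset.sum_range_id, Nat.choose_two_right]

/-- The upper unitriangular matrix with prescribed entries above the diagonal. -/
def unitriangularOf {n : ℕ} (v : AboveDiag n → ℝ) : Matrix (Fin n) (Fin n) ℝ :=
  Matrix.of fun i j => if h : i < j then v ⟨(i, j), h⟩ else if i = j then 1 else 0

theorem unitriangularOf_of_lt {n : ℕ} (v : AboveDiag n → ℝ) {i j : Fin n} (h : i < j) :
    unitriangularOf v i j = v ⟨(i, j), h⟩ := by simp [unitriangularOf, h]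

theorem unitriangularOf_mem {n : ℕ} (v : AboveDiag n → ℝ) :
    unitriangularOf v ∈ upperUnitriangular n :=
  ⟨fun i => by simp [unitriangularOf], fun i j h => by
    simp [unitriangularOf, h.not_gt, h.ne']⟩

theorem unitriangularOf_entries {n : ℕ} {x : Matrix (Fin n) (Fin n) ℝ}
    (hx : x ∈ upperUnitriangular n) : unitriangularOf (fun p => x p.1.1 p.1.2) = x := by
  ext i j
  rcases lt_trichotomy i j with h | rfl | h
  · rw [unitriangularOf_of_lt _ h]
  · rw [(unitriangularOf_mem _).1, hx.1]
  · rw [(unitriangularOf_mem _).2 _ _ h, hx.2 _ _ h]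

theorem continuous_unitriangularOf {n : ℕ} :
    Continuous (unitriangularOf : (AboveDiag n → ℝ) → Matrix (Fin n) (Fin n) ℝ) := by
  refine continuous_matrix fun i j => ?_
  by_cases h : i < j
  · simpa only [unitriangularOf_of_lt _ h] using continuous_apply _
  · simp only [unitriangularOf, Matrix.of_apply, dif_neg h]
    exact continuous_const

/-- Coordinates on the unipotent group, centred at `exp(e)`, in which the flow
`x ↦ exp(e) · dilate s (exp(-e) x)` is the multiplication by the scalar `s`: the left translation by
`exp(-e)` turns the flow into the dilation, and the signed powers turn the weights into `1`. -/
noncomputable def flowChart (n : ℕ) : (AboveDiag n → ℝ) ≃ₜ upperUnitriangular n where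
  toFun u := ⟨expShift n 1 * unitriangularOf fun p =>
      signedPowHomeo ((p.1.2 : ℕ) - p.1.1 - 1) (u p),
    mul_mem_upperUnitriangular (expShift_mem n 1) (unitriangularOf_mem _)⟩
  invFun x := fun p => (signedPowHomeo ((p.1.2 : ℕ) - p.1.1 - 1)).symm
    ((expShift n (-1) * x.1) p.1.1 p.1.2)
  left_inv u := by
    funext p
    have h := expShift_mul_cancel (-1) (unitriangularOf fun p : AboveDiag n =>
      signedPowHomeo ((p.1.2 : ℕ) - p.1.1 - 1) (u p))
    rw [neg_neg] at h
    simp only [h]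
    rw [unitriangularOf_of_lt _ p.2, Homeomorph.symm_apply_apply]
  right_inv x := by
    apply Subtype.ext
    simp only [Homeomorph.apply_symm_apply]
    rw [unitriangularOf_entries (mul_mem_upperUnitriangular (expShift_mem n (-1)) x.2),
      expShift_mul_cancel]
  continuous_toFun := by
    refine Continuous.subtype_mk (continuous_const.matrix_mul
      (continuous_unitriangularOf.comp (continuous_pi fun p => ?_))) _
    exact (Homeomorph.continuous _).comp (continuous_apply p)
  continuous_invFun := continuous_pi fun p => (Homeomorph.continuous _).comp
    ((continuous_const.matrix_mul continuous_subtype_val).matrix_elem _ _)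

theorem flowChart_apply {n : ℕ} (u : AboveDiag n → ℝ) :
    (flowChart n u).1 = expShift n 1 * unitriangularOf fun p =>
      signedPow ((p.1.2 : ℕ) - p.1.1 - 1) (u p) := rfl

theorem flowChart_smul {n : ℕ} {s : ℝ} (hs : 0 ≤ s) (u : AboveDiag n → ℝ) :
    (flowChart n (s • u)).1 = expShift n (1 - s) * dilate s (flowChart n u).1 := by
  rw [← expShift_mul_dilate s (flowChart n u).2, flowChart_apply, flowChart_apply]
  have h := expShift_mul_cancel (-1) (unitriangularOf fun p : AboveDiag n =>
    signedPow ((p.1.2 : ℕ) - p.1.1 - 1) (u p))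
  rw [neg_neg] at h
  rw [h]
  congr 1
  ext i j
  rcases lt_trichotomy i j with hij | rfl | hij
  · have h' : (i : ℕ) < j := hij
    rw [dilate_apply, unitriangularOf_of_lt _ hij, unitriangularOf_of_lt _ hij, Pi.smul_apply,
      smul_eq_mul, signedPow_mul _ hs]
    simp only
    rw [show (j : ℕ) - i - 1 + 1 = j - i by omega]
  · rw [(dilate_mem s (unitriangularOf_mem _)).1, (unitriangularOf_mem _).1]
  · rw [(dilate_mem s (unitriangularOf_mem _)).2 _ _ hij, (unitriangularOf_mem _).2 _ _ hij]

/-- The sum of the coordinates on the superdiagonal. -/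
def superdiagForm (n : ℕ) : (AboveDiag n → ℝ) →ₗ[ℝ] ℝ :=
  ∑ i : Fin (n - 1), LinearMap.proj
    (⟨(⟨i, by omega⟩, ⟨i + 1, by omega⟩), Fin.lt_def.2 (Nat.lt_succ_self _)⟩ : AboveDiag n)

theorem superdiagSum_flowChart {n : ℕ} (hn : 1 ≤ n) (u : AboveDiag n → ℝ) :
    superdiagSum (flowChart n u).1 = (n : ℝ) - 1 + superdiagForm n u := by
  rw [flowChart_apply, superdiagSum_mul (expShift_mem n 1) (unitriangularOf_mem _),
    superdiagSum_expShift hn, mul_one, superdiagForm, LinearMap.sum_apply]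
  congr 1
  refine Finset.sum_congr rfl fun i _ => ?_
  rw [unitriangularOf_of_lt _ (Fin.lt_def.2 (Nat.lt_succ_self _))]
  simp [signedPow]

theorem finrank_ker_superdiagForm {n : ℕ} (hn : 2 ≤ n) :
    Module.finrank ℝ (LinearMap.ker (superdiagForm n)) = n.choose 2 - 1 := by
  have hne : superdiagForm n ≠ 0 := by
    intro h
    have h1 := LinearMap.congr_fun h (fun _ => (1 : ℝ))
    simp only [superdiagForm, LinearMap.sum_apply, LinearMap.proj_apply, Finset.sum_const,
      Finset.card_univ, Fintype.card_fin, nsmul_eq_mul, mul_one, LinearMap.zero_apply,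
      Nat.cast_eq_zero] at h1
    omega
  have h := Module.Dual.finrank_ker_add_one_of_ne_zero (f := superdiagForm n) hne
  rw [Module.finrank_fintype_fun_eq_card, card_aboveDiag] at h
  omega

/-- The link of the identity in the linear coordinates of `flowChart`. -/
def linkChart (n : ℕ) : Set (LinearMap.ker (superdiagForm n)) :=
  {u | (flowChart n u.1).1 ∈ unipotentNonneg n}

/-- `flowChart` restricted to the link. -/
noncomputable def linkChartHomeo {n : ℕ} (hn : 1 ≤ n) : linkChart n ≃ₜ linkNonneg n where
  toFun u := ⟨(flowChart n u.1.1).1, u.2, by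
    have h := superdiagSum_flowChart hn u.1.1
    rwa [LinearMap.mem_ker.1 u.1.2, add_zero] at h⟩
  invFun x := ⟨⟨(flowChart n).symm ⟨x.1, x.2.1.1⟩, by
    have h := superdiagSum_flowChart hn ((flowChart n).symm ⟨x.1, x.2.1.1⟩)
    rw [Homeomorph.apply_symm_apply, (mem_linkNonneg.1 x.2).2] at h
    rw [LinearMap.mem_ker]
    linarith⟩, by
    change (flowChart n ((flowChart n).symm ⟨x.1, x.2.1.1⟩)).1 ∈ unipotentNonneg n
    rw [Homeomorph.apply_symm_apply]
    exact x.2.1⟩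
  left_inv u := by
    apply Subtype.ext
    apply Subtype.ext
    exact (flowChart n).symm_apply_apply u.1.1
  right_inv x := by
    apply Subtype.ext
    simp
  continuous_toFun := Continuous.subtype_mk (continuous_subtype_val.comp
    ((flowChart n).continuous.comp (continuous_subtype_val.comp continuous_subtype_val))) _
  continuous_invFun := Continuous.subtype_mk (Continuous.subtype_mk
    ((flowChart n).symm.continuous.comp (continuous_subtype_val.subtype_mk _)) _) _

theorem expShift_one_mem_linkNonneg {n : ℕ} (hn : 1 ≤ n) : expShift n 1 ∈ linkNonneg n :=
  mem_linkNonneg.2 ⟨expShift_mem_unipotentNonneg n zero_le_one, by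
    rw [superdiagSum_expShift hn, mul_one]⟩

/-- The flow moves the link into its own interior, because the nonvanishing minors of
`exp((1 - s)e)` are positive. -/
theorem smul_mem_interior_linkChart {n : ℕ} {u : LinearMap.ker (superdiagForm n)}
    (hu : u ∈ linkChart n) {s : ℝ} (hs : 0 ≤ s) (hs1 : s < 1) : s • u ∈ interior (linkChart n) := by
  refine mem_interior.2 ⟨{v | (flowChart n v.1).1 ∈ minorsPos n},
    fun v hv => mem_unipotentNonneg_of_minorsPos (flowChart n v.1).2 hv,
    (isOpen_minorsPos n).preimage (continuous_subtype_val.comp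
      ((flowChart n).continuous.comp continuous_subtype_val)), ?_⟩
  have h : (flowChart n (s • u).1).1 = _ := flowChart_smul hs u.1
  rw [Set.mem_ofPred_eq, h]
  exact expShift_mul_mem_minorsPos (sub_pos.2 hs1) (dilate_mem_unipotentNonneg hs hu)

theorem nonempty_linkNonneg_homeomorph {n : ℕ} (hn : 2 ≤ n) :
    Nonempty (linkNonneg n ≃ₜ
      Metric.closedBall (0 : EuclideanSpace ℝ (Fin (n.choose 2 - 1))) 1) := by
  have e := linkChartHomeo (n := n) (by omega)
  have : CompactSpace (linkNonneg n) := isCompact_iff_compactSpace.1 (isCompact_linkNonneg n)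
  obtain ⟨f⟩ := nonempty_homeomorph_closedBall_euclidean (finrank_ker_superdiagForm hn)
    (isCompact_iff_compactSpace.2 e.symm.compactSpace)
    ⟨_, (e.symm ⟨_, expShift_one_mem_linkNonneg (by omega)⟩).2⟩
    fun _ hu _ hs hs1 => smul_mem_interior_linkChart hu hs hs1
  exact ⟨e.symm.trans f⟩

/-! ### The cone over the link -/

section Cone

variable {n : ℕ}

/-- The dilation parameter of a point of `U_{≥0}`, seen as a point of the cone over the link. -/
noncomputable def height (x : Matrix (Fin n) (Fin n) ℝ) : ℝ := superdiagSum x / ((n : ℝ) - 1)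

theorem continuous_height : Continuous (height : Matrix (Fin n) (Fin n) ℝ → ℝ) :=
  continuous_superdiagSum.div_const _

theorem height_nonneg (hn : 2 ≤ n) {x : Matrix (Fin n) (Fin n) ℝ} (hx : x ∈ unipotentNonneg n) :
    0 ≤ height x := by
  have : (2 : ℝ) ≤ n := by exact_mod_cast hn
  exact div_nonneg (superdiagSum_nonneg hx) (by linarith)

theorem height_dilate (s : ℝ) (x : Matrix (Fin n) (Fin n) ℝ) :
    height (dilate s x) = s * height x := by
  rw [height, superdiagSum_dilate, mul_div_assoc, height]

theorem superdiagSum_eq_height (hn : 2 ≤ n) (x : Matrix (Fin n) (Fin n) ℝ) :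
    superdiagSum x = height x * ((n : ℝ) - 1) := by
  have : (2 : ℝ) ≤ n := by exact_mod_cast hn
  rw [height, div_mul_cancel₀ _ (by linarith)]

theorem height_of_mem_linkNonneg (hn : 2 ≤ n) {x : Matrix (Fin n) (Fin n) ℝ}
    (hx : x ∈ linkNonneg n) : height x = 1 := by
  have : (2 : ℝ) ≤ n := by exact_mod_cast hn
  rw [height, (mem_linkNonneg.1 hx).2, div_self (by linarith)]

theorem dilate_inv_height_mem (hn : 2 ≤ n) {x : Matrix (Fin n) (Fin n) ℝ}
    (hx : x ∈ unipotentNonneg n) (h : height x ≠ 0) :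
    dilate (height x)⁻¹ x ∈ linkNonneg n := by
  refine mem_linkNonneg.2
    ⟨dilate_mem_unipotentNonneg (inv_nonneg.2 (height_nonneg hn hx)) hx, ?_⟩
  rw [superdiagSum_eq_height hn, height_dilate, inv_mul_cancel₀ h, one_mul]

open Classical in
/-- The point of the link on the dilation orbit of `x`; an arbitrary point for `x = 1`. -/
noncomputable def linkPoint (hn : 2 ≤ n) (x : unipotentNonneg n) : linkNonneg n :=
  if h : height x.1 = 0 then ⟨_, expShift_one_mem_linkNonneg (by omega : 1 ≤ n)⟩
  else ⟨_, dilate_inv_height_mem hn x.2 h⟩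

theorem linkPoint_of_ne (hn : 2 ≤ n) {x : unipotentNonneg n} (h : height x.1 ≠ 0) :
    linkPoint hn x = ⟨_, dilate_inv_height_mem hn x.2 h⟩ := by rw [linkPoint, dif_neg h]

theorem dilate_linkPoint (hn : 2 ≤ n) (x : unipotentNonneg n) :
    dilate (height x.1) (linkPoint hn x).1 = x.1 := by
  by_cases h : height x.1 = 0
  · have hx : x.1 = 1 := eq_one_of_superdiagSum_eq_zero x.2 (by
      rw [superdiagSum_eq_height hn, h, zero_mul])
    rw [h, dilate_zero (linkPoint hn x).2.1.1, hx]
  · rw [linkPoint_of_ne hn h]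
    simp only [dilate_dilate, mul_inv_cancel₀ h, dilate_one]

theorem linkPoint_dilate (hn : 2 ≤ n) {s : ℝ} (hs : 0 < s) (v : linkNonneg n) :
    linkPoint hn ⟨dilate s v.1, dilate_mem_unipotentNonneg hs.le v.2.1⟩ = v := by
  have h : height (dilate s v.1) = s := by
    rw [height_dilate, height_of_mem_linkNonneg hn v.2, mul_one]
  rw [linkPoint_of_ne hn (by simpa only [h] using hs.ne')]
  apply Subtype.ext
  simp only [h, dilate_dilate, inv_mul_cancel₀ hs.ne', dilate_one]

theorem continuousAt_linkPoint (hn : 2 ≤ n) {x : unipotentNonneg n} (h : height x.1 ≠ 0) :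
    ContinuousAt (linkPoint hn) x := by
  have hh : Continuous fun y : unipotentNonneg n => height y.1 :=
    continuous_height.comp continuous_subtype_val
  have h1 : ContinuousAt (fun y : unipotentNonneg n => dilate (height y.1)⁻¹ y.1) x :=
    ContinuousAt.comp (g := fun p : ℝ × Matrix (Fin n) (Fin n) ℝ => dilate p.1 p.2)
      continuous_dilate.continuousAt
      ((hh.continuousAt.inv₀ h).prodMk continuous_subtype_val.continuousAt)
  rw [Topology.IsInducing.subtypeVal.continuousAt_iff]
  refine h1.congr ?_
  filter_upwards [hh.continuousAt.eventually_ne h] with y hy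
  simp only [Function.comp_apply, linkPoint_of_ne hn hy]

variable {E : Type*} [NormedAddCommGroup E] [NormedSpace ℝ E]

theorem inv_smul_mem_closedBall {p : ℝ × E} (hp : ‖p.2‖ ≤ p.1) :
    p.1⁻¹ • p.2 ∈ Metric.closedBall (0 : E) 1 := by
  have h0 : 0 ≤ p.1 := (norm_nonneg _).trans hp
  rw [mem_closedBall_zero_iff, norm_smul, norm_inv, Real.norm_of_nonneg h0]
  exact inv_mul_le_one_of_le₀ hp h0

/-- The point of height `p.1` on the dilation orbit through the link point that corresponds to
the direction of `p.2`. At the apex `p = 0` the division by `p.1` gives the link point of the centre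
of the ball, and `dilate 0` sends any point to the identity. -/
noncomputable def coneToUnipotent (f : linkNonneg n ≃ₜ Metric.closedBall (0 : E) 1)
    (p : {p : ℝ × E | ‖p.2‖ ≤ p.1}) : unipotentNonneg n :=
  ⟨dilate p.1.1 (f.symm ⟨_, inv_smul_mem_closedBall p.2⟩).1,
    dilate_mem_unipotentNonneg ((norm_nonneg _).trans p.2) (f.symm _).2.1⟩

theorem continuous_coneToUnipotent (hn : 2 ≤ n) (f : linkNonneg n ≃ₜ Metric.closedBall (0 : E) 1) :
    Continuous (coneToUnipotent f) := by
  have hfst : Continuous fun q : {p : ℝ × E | ‖p.2‖ ≤ p.1} => q.1.1 :=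
    continuous_fst.comp continuous_subtype_val
  refine continuous_iff_continuousAt.2 fun p => ?_
  rw [Topology.IsInducing.subtypeVal.continuousAt_iff]
  by_cases hp : p.1.1 = 0
  · -- at the apex, an entry at distance `d` from the diagonal is at most `(height * (n - 1)) ^ d`
    refine tendsto_pi_nhds.2 fun i => tendsto_pi_nhds.2 fun j => ?_
    rcases lt_or_ge i j with hij | hij
    · have h' : (i : ℕ) < j := hij
      have hval : (coneToUnipotent f p).1 i j = 0 := by
        simp [coneToUnipotent, dilate_apply, hp, (Nat.sub_pos_of_lt h').ne']
      have hbound : ∀ q : {p : ℝ × E | ‖p.2‖ ≤ p.1},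
          (coneToUnipotent f q).1 i j ≤ (q.1.1 * ((n : ℝ) - 1)) ^ ((j : ℕ) - i) := by
        intro q
        refine (entry_le_superdiagSum_pow (coneToUnipotent f q).2 (j - i) i j
          (by omega)).trans_eq ?_
        rw [superdiagSum_eq_height hn]
        simp only [coneToUnipotent]
        rw [height_dilate, height_of_mem_linkNonneg hn (f.symm _).2, mul_one]
      have hlim : Filter.Tendsto (fun q : {p : ℝ × E | ‖p.2‖ ≤ p.1} =>
          (q.1.1 * ((n : ℝ) - 1)) ^ ((j : ℕ) - i)) (𝓝 p) (𝓝 0) := by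
        have hc : Continuous fun q : {p : ℝ × E | ‖p.2‖ ≤ p.1} =>
            (q.1.1 * ((n : ℝ) - 1)) ^ ((j : ℕ) - i) := (hfst.mul continuous_const).pow _
        have := hc.tendsto p
        simpa [hp, (Nat.sub_pos_of_lt h').ne'] using this
      simp only [Function.comp_apply]
      rw [hval]
      exact squeeze_zero (fun q => entry_nonneg (coneToUnipotent f q).2 i j) hbound hlim
    · have hconst : ∀ q, (coneToUnipotent f q).1 i j = (1 : Matrix (Fin n) (Fin n) ℝ) i j := by
        intro q
        rcases hij.eq_or_lt with rfl | h
        · rw [(coneToUnipotent f q).2.1.1, Matrix.one_apply_eq]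
        · rw [(coneToUnipotent f q).2.1.2 _ _ h, Matrix.one_apply_ne h.ne']
      simp only [Function.comp_apply, hconst]
      exact tendsto_const_nhds
  · have h1 : ContinuousAt (fun q : {p : ℝ × E | ‖p.2‖ ≤ p.1} =>
        (⟨_, inv_smul_mem_closedBall q.2⟩ : Metric.closedBall (0 : E) 1)) p := by
      rw [Topology.IsInducing.subtypeVal.continuousAt_iff]
      exact (hfst.continuousAt.inv₀ hp).smul
        (continuous_snd.comp continuous_subtype_val).continuousAt
    have h2 := (continuous_subtype_val.comp f.symm.continuous).continuousAt.comp h1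
    exact ContinuousAt.comp (g := fun p : ℝ × Matrix (Fin n) (Fin n) ℝ => dilate p.1 p.2)
      continuous_dilate.continuousAt (hfst.continuousAt.prodMk h2)

theorem height_coneToUnipotent (hn : 2 ≤ n) (f : linkNonneg n ≃ₜ Metric.closedBall (0 : E) 1)
    (p : {p : ℝ × E | ‖p.2‖ ≤ p.1}) : height (coneToUnipotent f p).1 = p.1.1 := by
  simp only [coneToUnipotent]
  rw [height_dilate, height_of_mem_linkNonneg hn (f.symm _).2, mul_one]

theorem norm_height_smul_linkPoint_le (hn : 2 ≤ n)
    (f : linkNonneg n ≃ₜ Metric.closedBall (0 : E) 1) (x : unipotentNonneg n) :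
    ‖height x.1 • (f (linkPoint hn x)).1‖ ≤ height x.1 := by
  have h0 := height_nonneg hn x.2
  rw [norm_smul, Real.norm_of_nonneg h0]
  exact mul_le_of_le_one_right h0 (mem_closedBall_zero_iff.1 (f _).2)

theorem continuous_height_smul_linkPoint (hn : 2 ≤ n)
    (f : linkNonneg n ≃ₜ Metric.closedBall (0 : E) 1) :
    Continuous fun x : unipotentNonneg n => height x.1 • (f (linkPoint hn x)).1 := by
  have hh : Continuous fun y : unipotentNonneg n => height y.1 :=
    continuous_height.comp continuous_subtype_val
  refine continuous_iff_continuousAt.2 fun x => ?_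
  by_cases h : height x.1 = 0
  · rw [ContinuousAt, h, zero_smul]
    exact squeeze_zero_norm (a := fun y => height y.1) (norm_height_smul_linkPoint_le hn f) (by
      simpa [h] using hh.tendsto x)
  · exact hh.continuousAt.smul
      ((continuous_subtype_val.comp f.continuous).continuousAt.comp (continuousAt_linkPoint hn h))

/-- `U_{≥0}` is the cone over its link, with the dilations as the scaling of the cone. -/
noncomputable def unipotentNonnegHomeoCone (hn : 2 ≤ n)
    (f : linkNonneg n ≃ₜ Metric.closedBall (0 : E) 1) :
    unipotentNonneg n ≃ₜ {p : ℝ × E | ‖p.2‖ ≤ p.1} where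
  toFun x := ⟨(height x.1, height x.1 • (f (linkPoint hn x)).1),
    norm_height_smul_linkPoint_le hn f x⟩
  invFun := coneToUnipotent f
  left_inv x := by
    apply Subtype.ext
    by_cases h : height x.1 = 0
    · have hx : x.1 = 1 := eq_one_of_superdiagSum_eq_zero x.2 (by
        rw [superdiagSum_eq_height hn, h, zero_mul])
      simp only [coneToUnipotent, h]
      rw [dilate_zero (f.symm _).2.1.1, hx]
    · simp only [coneToUnipotent, smul_smul, inv_mul_cancel₀ h, one_smul, Subtype.coe_eta,
        Homeomorph.symm_apply_apply, dilate_linkPoint]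
  right_inv p := by
    apply Subtype.ext
    refine Prod.ext (height_coneToUnipotent hn f p) ?_
    have hp : ‖p.1.2‖ ≤ p.1.1 := p.2
    simp only [height_coneToUnipotent hn f p]
    rcases ((norm_nonneg _).trans hp).eq_or_lt with h | h
    · rw [← h, zero_smul, eq_comm, ← norm_le_zero_iff, h]
      exact hp
    · rw [coneToUnipotent, linkPoint_dilate hn h, Homeomorph.apply_symm_apply]
      simp only
      rw [smul_inv_smul₀ h.ne']
  continuous_toFun := Continuous.subtype_mk ((continuous_height.comp continuous_subtype_val).prodMk
    (continuous_height_smul_linkPoint hn f)) _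
  continuous_invFun := continuous_coneToUnipotent hn f

end Cone

theorem theorem4p1 (n : ℕ) (hn : 2 ≤ n) :
    Nonempty (linkNonneg n ≃ₜ
      Metric.closedBall (0 : EuclideanSpace ℝ (Fin (n.choose 2 - 1))) 1) ∧
    Nonempty (unipotentNonneg n ≃ₜ
      closedHalfSpace (N := n.choose 2) ⟨0, Nat.choose_pos hn⟩) := by
  obtain ⟨f⟩ := nonempty_linkNonneg_homeomorph hn
  obtain ⟨g⟩ := nonempty_homeomorph_closedHalfSpace (Nat.choose_pos hn)
  exact ⟨⟨f⟩, ⟨(unipotentNonnegHomeoCone hn f).trans g⟩⟩
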